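/- Let $S_\infty$ be the group of all permutations of $\mathbb{N}$ with the topology of pointwise convergence for its action on the discrete set $\mathbb{N}$ (a Polish topological group), and consider the continuous action of $S_\infty$ on itself by conjugations, $(g,x)\mapsto gxg^{-1}$. This action is not Rosenthal representable. Here a real Banach space $V$ is called a \emph{Rosenthal space} if it contains no $l_1$-sequence, that is, no bounded sequence $(x_n)$ for which there is $c>0$ with $c\sum_{i\in F}|a_i|\le\|\sum_{i\in F}a_ix_i\|$ for all finite $F\subset\mathbb{N}$ and all real $a_i$. A \emph{representation} of a $G$-space $X$ (a continuous action of a topological group $G$ on a space $X$) on a Banach space $V$ is a pair $(h,\alpha)$, where $h\colon G\to \mathrm{Iso}_l(V)$ is a continuous homomorphism into the group of linear isometries of $V$ onto itself with the strong operator topology, and $\alpha\colon X\to V^*$ is a norm bounded, weak-star continuous map with $\alpha(gx)(v)=\alpha(x)(h(g)^{-1}v)$ for all $g\in G$, $x\in X$, $v\in V$. The $G$-space $X$ is \emph{Rosenthal representable} if there are a Rosenthal space $V$ and a representation $(h,\alpha)$ of $X$ on $V$ such that $\alpha$ is a topological embedding of $X$ into $V^*$ with the weak-star topology. -/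

import Mathlib

open Topology

universe u v w

/-! ### The symmetric group `S_∞` -/

/-- The symmetric group `S_∞` of all permutations of `ℕ`. -/
abbrev SInfty : Type := Equiv.Perm ℕ

/-- The topology of pointwise convergence on `S_∞`, for its action on the discrete set `ℕ`. -/
instance SInfty.instTopologicalSpace : TopologicalSpace SInfty :=
  TopologicalSpace.induced (fun (g : SInfty) (n : ℕ) => g n) inferInstance

theorem SInfty.continuous_apply (n : ℕ) : Continuous (fun g : SInfty => g n) :=
  (_root_.continuous_apply n).comp continuous_induced_dom

theorem SInfty.continuous_iff {X : Type*} [TopologicalSpace X] {f : X → SInfty} :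
    Continuous f ↔ ∀ n, Continuous (fun x => f x n) := by
  rw [continuous_induced_rng, continuous_pi_iff]
  rfl

instance SInfty.instIsTopologicalGroup : IsTopologicalGroup SInfty where
  continuous_mul := by
    rw [SInfty.continuous_iff]
    intro n
    rw [continuous_discrete_rng]
    intro b
    rw [isOpen_iff_forall_mem_open]
    rintro ⟨g, h⟩ hgh
    refine ⟨{p | p.2 n = h n} ∩ {p | p.1 (h n) = b}, ?_, ?_, ?_⟩
    · rintro ⟨p, q⟩ ⟨h1, h2⟩
      change q n = h n at h1
      change p (h n) = b at h2
      simp [h1, h2]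
    · exact (((isOpen_discrete {h n}).preimage
          ((SInfty.continuous_apply n).comp continuous_snd))).inter
        ((isOpen_discrete {b}).preimage ((SInfty.continuous_apply (h n)).comp continuous_fst))
    · exact ⟨rfl, by simpa using hgh⟩
  continuous_inv := by
    rw [SInfty.continuous_iff]
    intro n
    rw [continuous_discrete_rng]
    intro b
    have : (fun g : SInfty => g⁻¹ n) ⁻¹' {b} = (fun g : SInfty => g b) ⁻¹' {n} := by
      ext g
      simp only [Set.mem_preimage, Set.mem_singleton_iff, Equiv.Perm.inv_eq_iff_eq]
      exact eq_comm
    rw [this]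
    exact (isOpen_discrete {n}).preimage (SInfty.continuous_apply b)

/-! ### The conjugation action -/

/-- The `G`-space `G_c`: the space `G`, on which `G` acts by conjugations. -/
def ConjSpace (G : Type*) : Type _ := G

namespace ConjSpace

instance instTopologicalSpace (G : Type*) [TopologicalSpace G] : TopologicalSpace (ConjSpace G) :=
  inferInstanceAs (TopologicalSpace G)

/-- `g • x = g * x * g⁻¹`. -/
instance instMulAction (G : Type*) [Group G] : MulAction G (ConjSpace G) where
  smul g x := (g * (show G from x) * g⁻¹ : G)
  one_smul x := by
    let y : G := x
    have hy : 1 * y * 1⁻¹ = y := by simp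
    exact hy
  mul_smul g h x := by
    let y : G := x
    have hy : g * h * y * (g * h)⁻¹ = g * (h * y * h⁻¹) * g⁻¹ := by group
    exact hy

instance instContinuousSMul (G : Type*) [Group G] [TopologicalSpace G] [IsTopologicalGroup G] :
    ContinuousSMul G (ConjSpace G) where
  continuous_smul := show Continuous (fun p : G × G => p.1 * p.2 * p.1⁻¹) by fun_prop

end ConjSpace

/-! ### Rosenthal Banach spaces -/

/-- `x` is an `l₁`-sequence: a bounded sequence which is equivalent to the unit vector basis
of `l₁`. -/
def IsL1Sequence {V : Type*} [NormedAddCommGroup V] [NormedSpace ℝ V] (x : ℕ → V) : Prop :=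
  (∃ C : ℝ, ∀ n, ‖x n‖ ≤ C) ∧
    ∃ c : ℝ, 0 < c ∧ ∀ (s : Finset ℕ) (a : ℕ → ℝ),
      c * ∑ i ∈ s, |a i| ≤ ‖∑ i ∈ s, a i • x i‖

/-- A Rosenthal space: a (real Banach) space that contains no `l₁`-sequence. -/
def IsRosenthalSpace (V : Type*) [NormedAddCommGroup V] [NormedSpace ℝ V] : Prop :=
  ¬ ∃ x : ℕ → V, IsL1Sequence x

/-! ### Representations of `G`-spaces on Banach spaces -/

/-- The strong operator topology on the group `Iso_l(V)` of linear isometries of `V` onto `V`. -/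
abbrev strongOperatorTopology (V : Type*) [NormedAddCommGroup V] [NormedSpace ℝ V] :
    TopologicalSpace (V ≃ₗᵢ[ℝ] V) :=
  TopologicalSpace.induced (fun (T : V ≃ₗᵢ[ℝ] V) (v : V) => T v) inferInstance

/-- A representation `(h, α)` of the `G`-space `X` on `V`: a strongly continuous homomorphism
`h : G → Iso_l(V)` and a weak-star continuous bounded map `α : X → V*` which is equivariant for
the dual action `(g u)(v) = u (g⁻¹ v)`. -/
structure BanachRepresentation (G X V : Type*)
    [Group G] [TopologicalSpace G] [IsTopologicalGroup G]
    [TopologicalSpace X] [MulAction G X] [ContinuousSMul G X]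
    [NormedAddCommGroup V] [NormedSpace ℝ V] where
  h : G →* (V ≃ₗᵢ[ℝ] V)
  continuous_h : @Continuous _ _ _ (strongOperatorTopology V) h
  α : X → WeakDual ℝ V
  continuous_α : Continuous α
  bounded_α : ∃ C : ℝ, ∀ x, ‖WeakDual.toStrongDual (α x)‖ ≤ C
  equivariant : ∀ (g : G) (x : X) (v : V), α (g • x) v = α x (h g⁻¹ v)

/-- A representation is proper if `α` is a topological embedding into `V*` with its weak-star
topology. -/
def BanachRepresentation.IsProper {G X V : Type*}
    [Group G] [TopologicalSpace G] [IsTopologicalGroup G]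
    [TopologicalSpace X] [MulAction G X] [ContinuousSMul G X]
    [NormedAddCommGroup V] [NormedSpace ℝ V] (ρ : BanachRepresentation G X V) : Prop :=
  IsEmbedding ρ.α

/-- The `G`-space `X` is Rosenthal representable: it has a proper representation on some
Rosenthal Banach space (in the universe `u`). -/
def RosenthalRepresentable (G : Type v) (X : Type w)
    [Group G] [TopologicalSpace G] [IsTopologicalGroup G]
    [TopologicalSpace X] [MulAction G X] [ContinuousSMul G X] : Prop :=
  ∃ (V : Type u) (_ : NormedAddCommGroup V) (_ : NormedSpace ℝ V) (_ : CompleteSpace V),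
    IsRosenthalSpace V ∧ ∃ ρ : BanachRepresentation G X V, ρ.IsProper

/-! For fixed `v`, the function `f x = ρ.α x v` is continuous, so up to a small error its values
near `1` and near the transposition `(0 1)` depend only on the action on some block `[0, N)`. A
permutation can act as `(0 1)` or trivially on each of infinitely many blocks independently, and
conjugation brings any block to the front. By equivariance, if `f` separated `(0 1)` from `1`, the
translates of `v` under the block swaps would form an independent, hence `l₁`, sequence. So `ρ.α` is
not injective. -/

/-- A neighbourhood of a permutation contains all permutations that agree with it on a
sufficiently long initial segment. -/
theorem SInfty.eventually_of_eqOn {y : SInfty} {p : SInfty → Prop} (h : ∀ᶠ x in 𝓝 y, p x) :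
    ∀ᶠ N : ℕ in Filter.atTop, ∀ x : SInfty, (∀ k < N, x k = y k) → p x := by
  rw [nhds_induced, Filter.eventually_comap, nhds_pi] at h
  obtain ⟨I, hI, t, ht, hsub⟩ := Filter.mem_pi.1 h
  obtain ⟨M, hM⟩ := hI.bddAbove
  filter_upwards [Filter.eventually_gt_atTop M] with N hN x hx
  refine hsub (a := fun n => x n) (fun i hi => ?_) x rfl
  simp only [hx i ((hM hi).trans_lt hN)]
  exact mem_of_mem_nhds (ht i)

/-- The permutation of `ℕ` exchanging the blocks `[0, N)` and `[nN, (n+1)N)`. -/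
def blockSwap (N : ℕ) [NeZero N] (n : ℕ) : SInfty :=
  (Nat.divModEquiv N).symm.permCongr (Equiv.prodCongr (Equiv.swap 0 n) (Equiv.refl _))

open Classical in
/-- The permutation of `ℕ` acting as `σ` on each block `[nN, (n+1)N)` with `n ∈ A` and trivially
elsewhere. -/
noncomputable def blockPerm (N : ℕ) [NeZero N] (σ : Equiv.Perm (Fin N)) (A : Set ℕ) : SInfty :=
  (Nat.divModEquiv N).symm.permCongr
    (Equiv.prodShear (Equiv.refl ℕ) fun n => if n ∈ A then σ else 1)

-- The swap carries block `0` to block `n`, so the conjugate sees on `[0, N)` only whether `n ∈ A`.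
-- Its values elsewhere do not matter.
open Classical in
theorem blockSwap_conj_blockPerm_apply {N : ℕ} [NeZero N] (σ : Equiv.Perm (Fin N)) (A : Set ℕ)
    (n : ℕ) (k : Fin N) :
    ((blockSwap N n)⁻¹ * blockPerm N σ A * blockSwap N n) (k : ℕ) =
      ((if n ∈ A then σ k else k : Fin N) : ℕ) := by
  have hk : ∀ j : Fin N, (Nat.divModEquiv N).symm (0, j) = (j : ℕ) := fun j => by
    simp [Nat.divModEquiv]
  rw [mul_assoc, Equiv.Perm.mul_apply, Equiv.Perm.inv_eq_iff_eq, Equiv.Perm.mul_apply, ← hk k,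
    ← hk (if n ∈ A then σ k else k)]
  unfold blockSwap blockPerm
  generalize Nat.divModEquiv N = e
  by_cases h : n ∈ A <;> simp [Equiv.permCongr_apply, Equiv.prodShear, h]

/-- A bounded sequence of vectors whose pairings with a bounded family of functionals can be
prescribed, up to a quarter of `|b - a|`, to be `b` on any set of indices and `a` on its
complement is an `l₁`-sequence. -/
theorem isL1Sequence_of_independent {V : Type*} [NormedAddCommGroup V] [NormedSpace ℝ V]
    {x : ℕ → V} {B : ℝ} (hB : ∀ n, ‖x n‖ ≤ B) {a b C : ℝ} (hab : a ≠ b)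
    (φ : Set ℕ → StrongDual ℝ V) (hC : ∀ A, ‖φ A‖ ≤ C)
    (hmem : ∀ A, ∀ n ∈ A, |φ A (x n) - b| ≤ |b - a| / 4)
    (hnmem : ∀ A, ∀ n ∉ A, |φ A (x n) - a| ≤ |b - a| / 4) : IsL1Sequence x := by
  have hd : 0 < |b - a| := abs_pos.2 (sub_ne_zero.2 hab.symm)
  have hC0 : 0 ≤ C := (norm_nonneg _).trans (hC ∅)
  -- One factor 2 pays for the approximation error, the other for using two functionals; `C + 1`
  -- keeps the denominator positive.
  refine ⟨⟨B, hB⟩, |b - a| / (4 * (C + 1)), by positivity, fun s c => ?_⟩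
  -- With this `A`, `φ A - φ Aᶜ` is about `b - a` on `x i` when `c i > 0` and `a - b` otherwise, so
  -- all terms add up without cancellation.
  let A : Set ℕ := {n | 0 < c n}
  have hterm : ∀ i, |c i * (φ A (x i) - φ Aᶜ (x i)) - (b - a) * (|c i|)| ≤ |b - a| / 2 * |c i| := by
    intro i
    by_cases hi : 0 < c i
    · have h1 := hmem A i hi
      have h2 := hnmem Aᶜ i (fun h => h hi)
      rw [abs_of_pos hi, show c i * (φ A (x i) - φ Aᶜ (x i)) - (b - a) * c i =
        ((φ A (x i) - b) - (φ Aᶜ (x i) - a)) * c i by ring, abs_mul, abs_of_pos hi]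
      refine mul_le_mul_of_nonneg_right ?_ hi.le
      linarith [abs_sub (φ A (x i) - b) (φ Aᶜ (x i) - a)]
    · have h1 := hnmem A i hi
      have h2 := hmem Aᶜ i hi
      rw [abs_of_nonpos (not_lt.1 hi), show c i * (φ A (x i) - φ Aᶜ (x i)) - (b - a) * -c i =
        ((φ A (x i) - a) - (φ Aᶜ (x i) - b)) * c i by ring, abs_mul, abs_of_nonpos (not_lt.1 hi)]
      refine mul_le_mul_of_nonneg_right ?_ (by linarith)
      linarith [abs_sub (φ A (x i) - a) (φ Aᶜ (x i) - b)]
  set v := ∑ i ∈ s, c i • x i with hv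
  set S := ∑ i ∈ s, |c i| with hS
  have hS0 : 0 ≤ S := Finset.sum_nonneg fun i _ => abs_nonneg _
  have hsum : |(φ A v - φ Aᶜ v) - (b - a) * S| ≤ |b - a| / 2 * S := by
    have h : (φ A v - φ Aᶜ v) - (b - a) * S =
        ∑ i ∈ s, (c i * (φ A (x i) - φ Aᶜ (x i)) - (b - a) * (|c i|)) := by
      simp [hv, hS, mul_sub, Finset.sum_sub_distrib, Finset.mul_sum]
    rw [h, hS, Finset.mul_sum]
    exact (Finset.abs_sum_le_sum_abs _ _).trans (Finset.sum_le_sum fun i _ => hterm i)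
  have hlow : |b - a| / 2 * S ≤ |φ A v - φ Aᶜ v| := by
    have := abs_sub_abs_le_abs_sub ((b - a) * S) (φ A v - φ Aᶜ v)
    rw [abs_sub_comm ((b - a) * S), abs_mul, abs_of_nonneg hS0] at this
    linarith
  have hup : ∀ A, |φ A v| ≤ (C + 1) * ‖v‖ := fun A =>
    ((φ A).le_opNorm v).trans
      (mul_le_mul_of_nonneg_right ((hC A).trans (by linarith)) (norm_nonneg v))
  have hfin : |b - a| / 2 * S ≤ 2 * ((C + 1) * ‖v‖) := by
    linarith [abs_sub (φ A v) (φ Aᶜ v), hup A, hup Aᶜ]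
  rw [div_mul_eq_mul_div, div_le_iff₀ (by positivity)]
  linarith

/-- A representation of `S_∞`, acting on itself by conjugations, on a Rosenthal space does not
separate a finitely supported transposition from the identity. -/
theorem BanachRepresentation.apply_swap_eq_apply_one {V : Type*} [NormedAddCommGroup V]
    [NormedSpace ℝ V] (hV : IsRosenthalSpace V)
    (ρ : BanachRepresentation SInfty (ConjSpace SInfty) V) :
    ρ.α (Equiv.swap 0 1 : SInfty) = ρ.α (1 : SInfty) := by
  refine ContinuousLinearMap.ext fun v => ?_
  by_contra hne
  let f : SInfty → ℝ := fun x => ρ.α x v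
  have hf : Continuous f := (WeakDual.eval_continuous v).comp ρ.continuous_α
  have hd : 0 < |f (Equiv.swap 0 1) - f 1| / 4 := by
    have := abs_pos.2 (sub_ne_zero.2 hne)
    exact div_pos this four_pos
  have near : ∀ y : SInfty, ∀ᶠ N : ℕ in Filter.atTop, ∀ x : SInfty, (∀ k < N, x k = y k) →
      |f x - f y| < |f (Equiv.swap 0 1) - f 1| / 4 := fun y =>
    SInfty.eventually_of_eqOn (hf.continuousAt.eventually (Metric.ball_mem_nhds _ hd))
  obtain ⟨N, ⟨h1, h2⟩, hN⟩ :=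
    (((near 1).and (near (Equiv.swap 0 1))).and (Filter.eventually_ge_atTop 2)).exists
  -- Writing `N = M + 2` makes `0` and `1` distinct elements of `Fin N`.
  obtain ⟨M, rfl⟩ := Nat.exists_eq_add_of_le' hN
  obtain ⟨C, hC⟩ := ρ.bounded_α
  let σ : Equiv.Perm (Fin (M + 2)) := Equiv.swap 0 1
  have hσ : ∀ k : Fin (M + 2), ((σ k : Fin (M + 2)) : ℕ) = Equiv.swap 0 1 (k : ℕ) := by
    intro k
    simp only [σ, Equiv.swap_apply_def, Fin.ext_iff]
    split_ifs <;> simp_all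
  have hφ : ∀ A n, ρ.α (blockPerm (M + 2) σ A : SInfty) (ρ.h (blockSwap (M + 2) n) v) =
      f ((blockSwap (M + 2) n)⁻¹ * blockPerm (M + 2) σ A * blockSwap (M + 2) n) := by
    intro A n
    have := ρ.equivariant (blockSwap (M + 2) n)⁻¹ (blockPerm (M + 2) σ A : SInfty) v
    rw [inv_inv] at this
    rw [← this]
    change f ((blockSwap (M + 2) n)⁻¹ * blockPerm (M + 2) σ A * (blockSwap (M + 2) n)⁻¹⁻¹) = _
    rw [inv_inv]
  -- Here `b = f (Equiv.swap 0 1)` and `a = f 1`.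
  refine hV ⟨fun n => ρ.h (blockSwap (M + 2) n) v, isL1Sequence_of_independent (B := ‖v‖)
    (fun n => (LinearIsometryEquiv.norm_map _ _).le) (Ne.symm hne)
    (fun A => WeakDual.toStrongDual (ρ.α (blockPerm (M + 2) σ A : SInfty))) (fun A => hC _)
    (fun A n hn => ?_) (fun A n hn => ?_)⟩
  · rw [WeakDual.toStrongDual_apply, hφ]
    refine (h2 _ fun k hk => ?_).le
    have := blockSwap_conj_blockPerm_apply σ A n ⟨k, hk⟩
    rw [if_pos hn, hσ] at this
    exact this
  · rw [WeakDual.toStrongDual_apply, hφ]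
    refine (h1 _ fun k hk => ?_).le
    have := blockSwap_conj_blockPerm_apply σ A n ⟨k, hk⟩
    rw [if_neg hn] at this
    exact this

theorem mainTheorem9 : ¬ RosenthalRepresentable.{u, 0, 0} SInfty (ConjSpace SInfty) := by
  rintro ⟨V, _, _, _, hV, ρ, hρ⟩
  have h : (Equiv.swap 0 1 : SInfty) = 1 := hρ.injective (ρ.apply_swap_eq_apply_one hV)
  exact zero_ne_one (Equiv.swap_eq_one_iff.1 h)
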